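/- Let $N\in\mathbb N$ and let $\{S_n\}_{n\in\mathbb Z}$ be a sequence of Hermitian complex $N\times N$ matrices. A solution of the strong matrix Stieltjes moment problem with moments $\{S_n\}_{n\in\mathbb Z}$ is a non-decreasing $\mathbb C^{N\times N}$-valued function $M$ on $\mathbb R_+=[0,+\infty)$ (that is, $M(y)-M(x)$ is positive semidefinite whenever $0\le x\le y$) which is left-continuous on $(0,+\infty)$, satisfies $M(0)=0$, and is such that for every $n\in\mathbb Z$ the entrywise Lebesgue–Stieltjes integral $\int_{\mathbb R_+}x^n\,dM(x)$ converges absolutely and $$\int_{\mathbb R_+} x^n\,dM(x)=S_n,\qquad n\in\mathbb Z,$$ where $0^n=+\infty$ for $n<0$ (so that $dM$ has no mass at $0$). For $n=0,1,2,\dots$ let $$\Gamma_n=(S_{i+j})_{i,j=-n}^n,\qquad \widetilde\Gamma_n=(S_{i+j+1})_{i,j=-n}^n$$ be the block Hankel matrices of size $(2n+1)N\times(2n+1)N$. Then the moment problem has a solution if and only if $\Gamma_n\ge 0$ and $\widetilde\Gamma_n\ge 0$ (positive semidefinite) for all $n=0,1,2,\dots$. -/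

import Mathlib

open MeasureTheory
open scoped Matrix NNReal ENNReal ComplexOrder

/-- A non-decreasing `N × N` complex matrix function `M` on `[0, ∞)` with `M 0 = 0` which is
left-continuous on `(0, ∞)`. Here `A ≤ B` means that `B - A` is positive semidefinite. -/
structure StieltjesMatrixFunction (N : ℕ) where
  toFun : ℝ≥0 → Matrix (Fin N) (Fin N) ℂ
  map_zero : toFun 0 = 0
  mono : ∀ x y : ℝ≥0, x ≤ y → (toFun y - toFun x).PosSemidef
  left_continuous : ∀ x : ℝ≥0, 0 < x → ContinuousWithinAt toFun (Set.Iic x) x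

namespace StieltjesMatrixFunction

variable {N : ℕ}

/-- The scalar function `x ↦ v* M(x) v`, extended by `0` to the negative half-axis. -/
noncomputable def quad (M : StieltjesMatrixFunction N) (v : Fin N → ℂ) (x : ℝ) : ℝ :=
  (star v ⬝ᵥ (M.toFun x.toNNReal *ᵥ v)).re

theorem quad_mono (M : StieltjesMatrixFunction N) (v : Fin N → ℂ) : Monotone (M.quad v) := by
  intro x y hxy
  have h := (M.mono _ _ (Real.toNNReal_le_toNNReal hxy)).re_dotProduct_nonneg v
  rw [Matrix.sub_mulVec, dotProduct_sub, map_sub] at h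
  exact sub_nonneg.mp h

/-- The Lebesgue–Stieltjes measure of the non-decreasing function `x ↦ v* M(x) v`. It gives
`[a, b)` the mass `v* (M(b) - M(a)) v` for `0 ≤ a ≤ b`, and gives `{0}` the mass
`v* M(0+) v`. -/
noncomputable def quadMeasure (M : StieltjesMatrixFunction N) (v : Fin N → ℂ) : Measure ℝ :=
  (M.quad_mono v).stieltjesFunction.measure

/-- The vector `e_k + i^s e_l`. -/
noncomputable def polVec (k l : Fin N) (s : Fin 4) : Fin N → ℂ :=
  Pi.single k 1 + Complex.I ^ (s : ℕ) • Pi.single l 1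

/-- Every entry of `M` is a complex linear combination of four non-decreasing functions
`x ↦ v* M(x) v`. -/
theorem entry_eq (M : StieltjesMatrixFunction N) (k l : Fin N) (x : ℝ) :
    M.toFun x.toNNReal k l =
      (1 / 4 : ℂ) * ∑ s : Fin 4, (-Complex.I) ^ (s : ℕ) * (M.quad (polVec k l s) x : ℂ) := by
  have hP : (M.toFun x.toNNReal).PosSemidef := by
    simpa [M.map_zero] using M.mono 0 x.toNNReal zero_le
  have hre : ∀ v, (M.quad v x : ℂ) = star v ⬝ᵥ (M.toFun x.toNNReal *ᵥ v) := by
    intro v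
    have h := hP.dotProduct_mulVec_nonneg v
    exact (Complex.eq_re_of_ofReal_le (r := 0) (by simpa using h)).symm
  simp only [hre, polVec, Fin.sum_univ_four, star_add, star_smul, Matrix.mulVec_add,
    Matrix.mulVec_smul, dotProduct_add, add_dotProduct, smul_dotProduct, dotProduct_smul]
  simp [pow_succ]
  ring_nf
  simp [Complex.I_sq]
  ring

/-- The Lebesgue–Stieltjes integral `∫ xⁿ dM(x)` over `[0, ∞)` converges absolutely. The integrand
takes values in `[0, ∞]`, with `0 ^ n = ∞` for `n < 0`; thus convergence for some `n < 0` entails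
that `dM` has no mass at `0`. -/
def MomentConverges (M : StieltjesMatrixFunction N) (n : ℤ) : Prop :=
  ∀ v : Fin N → ℂ, ∫⁻ x in Set.Ici (0 : ℝ), ENNReal.ofReal x ^ n ∂(M.quadMeasure v) < ∞

/-- The matrix `∫ xⁿ dM(x)` over `[0, ∞)`, whose `(k, l)` entry is the Lebesgue–Stieltjes integral
of `xⁿ` with respect to the `(k, l)` entry of `M`, the latter being written as the combination
`(1/4) ∑ (-i)^s v_s* M(x) v_s`, `v_s = e_k + i^s e_l`, of non-decreasing functions. -/
noncomputable def moment (M : StieltjesMatrixFunction N) (n : ℤ) : Matrix (Fin N) (Fin N) ℂ :=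
  Matrix.of fun k l =>
    (1 / 4 : ℂ) * ∑ s : Fin 4, (-Complex.I) ^ (s : ℕ) *
      ((∫ x in Set.Ici (0 : ℝ), x ^ n ∂(M.quadMeasure (polVec k l s)) : ℝ) : ℂ)

/-- `M` solves the strong matrix Stieltjes moment problem with moments `S n`, `n ∈ ℤ`. -/
def IsSolution (M : StieltjesMatrixFunction N) (S : ℤ → Matrix (Fin N) (Fin N) ℂ) : Prop :=
  ∀ n : ℤ, M.MomentConverges n ∧ M.moment n = S n

end StieltjesMatrixFunction

/-- The block matrix `(S (i + j + d))`, `-n ≤ i, j ≤ n`. -/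
def blockHankel {N : ℕ} (S : ℤ → Matrix (Fin N) (Fin N) ℂ) (d : ℤ) (n : ℕ) :
    Matrix (Set.Icc (-(n : ℤ)) n × Fin N) (Set.Icc (-(n : ℤ)) n × Fin N) ℂ :=
  Matrix.of fun p q => S (p.1 + q.1 + d) p.2 q.2

/-! Sufficiency. Positivity of all `Γ_n` makes `S (i + j)` the Gram kernel of vectors `e (i, k)` in
an inner product space. The shift `i ↦ i + 1` acts there as a symmetric operator `X`, which is
positive because of the matrices `Γ̃_n` (`Matrix.PosSemidef.exists_gram_shift`). Compressing `X` to
the span of finitely many `e (i, k)` and diagonalizing yields point masses on `(0, ∞)` with the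
right moments up to order `n` (`exists_discrete_moments`).

For each `v` the scalar measures `v* dM_n v` converge vaguely along one fixed ultrafilter, and the
moments of orders `m ± 1` prevent loss of mass at `0` and `∞` in the moment of order `m`
(`exists_measure_of_pointSum_moments`). Since the ultrafilter is the same for all `v`, the limit
masses of `(0, x)` still depend on `v` as a quadratic form, and polarization recovers `M(x)`.

Necessity. The measures `v* dM v` have densities with respect to one measure `τ`, given by a matrix
`D(x)` that is positive semidefinite almost everywhere. The Hankel form at `(u_i)` is then `∫ x^d
p(x)* D(x) p(x) dτ` with `p(x) = ∑ x^i u_i`, which is nonnegative since `τ` lives on `(0, ∞)`. -/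

/-! ### The shift operator and the truncated problem -/

/-- A positive semidefinite kernel gives a semi-inner product on finitely supported functions. -/
noncomputable abbrev Matrix.PosSemidef.innerCore {ι : Type*} {K : Matrix ι ι ℂ}
    (hK : K.PosSemidef) : PreInnerProductSpace.Core ℂ (ι →₀ ℂ) where
  inner u v := u.sum fun i a => v.sum fun j b => star a * K i j * b
  conj_inner_symm u v := by
    simp only [Finsupp.sum, map_sum]
    rw [Finset.sum_comm]
    refine Finset.sum_congr rfl fun i _ => Finset.sum_congr rfl fun j _ => ?_
    have := hK.1.apply i j
    simp only [map_mul, RCLike.star_def, RingHomCompTriple.comp_apply, RingHom.id_apply] at *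
    rw [this]; ring
  re_inner_nonneg u := (Complex.le_def.1 (hK.2 u)).1
  add_left u v w := by
    classical
    rw [Finsupp.sum_add_index'] <;> simp [add_mul, Finsupp.sum_add]
  smul_left u v r := by
    rw [Finsupp.sum_smul_index'] <;> simp [Finsupp.mul_sum, mul_assoc]

/-- A positive semidefinite kernel `K` which is symmetric and positive with respect to a shift `σ`
is the Gram matrix of a family in an inner product space, on which the shift acts as a symmetric
positive operator. -/
theorem Matrix.PosSemidef.exists_gram_shift {ι : Type} {K : Matrix ι ι ℂ} (hK : K.PosSemidef)
    (σ : ι → ι) (hσ : ∀ i j, K (σ i) j = K i (σ j))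
    (hpos : (K.submatrix σ id).PosSemidef) :
    ∃ (E : Type) (_ : NormedAddCommGroup E) (_ : InnerProductSpace ℂ E) (e : ι → E)
      (X : E →ₗ[ℂ] E), X.IsSymmetric ∧ (∀ u, 0 ≤ (inner ℂ (X u) u).re) ∧
      (∀ i, X (e i) = e (σ i)) ∧ ∀ i j, inner ℂ (e i) (e j) = K i j := by
  classical
  let core := hK.innerCore
  let : SeminormedAddCommGroup (ι →₀ ℂ) :=
    InnerProductSpace.Core.toSeminormedAddCommGroup (𝕜 := ℂ)
  let : InnerProductSpace ℂ (ι →₀ ℂ) := InnerProductSpace.ofCore core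
  have hin : ∀ u v : ι →₀ ℂ, inner ℂ u v =
    u.sum fun i a => v.sum fun j b => star a * K i j * b := fun _ _ => rfl
  let T : (ι →₀ ℂ) →ₗ[ℂ] (ι →₀ ℂ) := Finsupp.lmapDomain ℂ ℂ σ
  have hTl : ∀ u v, inner ℂ (T u) v =
      u.sum fun i a => v.sum fun j b => star a * K (σ i) j * b := by
    intro u v
    rw [hin]
    simp only [T, Finsupp.lmapDomain_apply]
    rw [Finsupp.sum_mapDomain_index] <;> simp [add_mul, Finsupp.sum_add]
  have hTs : ∀ u v, inner ℂ (T u) v = inner ℂ u (T v) := by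
    intro u v
    rw [hTl, hin]
    refine Finset.sum_congr rfl fun i _ => ?_
    simp only [T, Finsupp.lmapDomain_apply]
    rw [Finsupp.sum_mapDomain_index] <;> simp [mul_add, hσ]
  have hTp : ∀ u, 0 ≤ (inner ℂ (T u) u).re := by
    intro u
    rw [hTl]
    exact (Complex.le_def.1 (hpos.2 u)).1
  -- By symmetry `‖T u‖² = ⟪T (T u), u⟫`, and Cauchy–Schwarz makes this vanish on null vectors; so
  -- `T` descends to the quotient.
  have hnull : ∀ u : ι →₀ ℂ, ‖u‖ = 0 → ‖T u‖ = 0 := by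
    intro u hu
    have h1 : inner ℂ (T u) (T u) = (0 : ℂ) := by
      rw [← hTs]
      have := norm_inner_le_norm (𝕜 := ℂ) (T (T u)) u
      rw [hu, mul_zero] at this
      exact norm_le_zero_iff.1 this
    have h2 := inner_self_eq_norm_sq_to_K (𝕜 := ℂ) (T u)
    rw [h1] at h2
    have := h2.symm
    simpa using this
  have hins : ∀ u v : ι →₀ ℂ, Inseparable u v → Inseparable (T u) (T v) := by
    intro u v h
    rw [Metric.inseparable_iff, dist_eq_norm] at h ⊢
    rw [← map_sub]
    exact hnull _ h
  let X : SeparationQuotient (ι →₀ ℂ) →ₗ[ℂ] SeparationQuotient (ι →₀ ℂ) :=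
    { toFun := SeparationQuotient.lift (fun u => SeparationQuotient.mk (T u))
        fun u v h => SeparationQuotient.mk_eq_mk.2 (hins u v h)
      map_add' := by
        intro a b
        obtain ⟨a, rfl⟩ := SeparationQuotient.surjective_mk a
        obtain ⟨b, rfl⟩ := SeparationQuotient.surjective_mk b
        exact congrArg SeparationQuotient.mk (map_add T a b)
      map_smul' := by
        intro c b
        obtain ⟨b, rfl⟩ := SeparationQuotient.surjective_mk b
        exact congrArg SeparationQuotient.mk (map_smul T c b) }
  have hX : ∀ u, X (SeparationQuotient.mk u) = SeparationQuotient.mk (T u) := fun _ => rfl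
  refine ⟨SeparationQuotient (ι →₀ ℂ), inferInstance, inferInstance,
    fun i => SeparationQuotient.mk (Finsupp.single i 1), X, ?_, ?_, ?_, ?_⟩
  · intro a b
    obtain ⟨a, rfl⟩ := SeparationQuotient.surjective_mk a
    obtain ⟨b, rfl⟩ := SeparationQuotient.surjective_mk b
    rw [hX, hX, SeparationQuotient.inner_mk_mk, SeparationQuotient.inner_mk_mk]
    exact hTs _ _
  · intro a
    obtain ⟨a, rfl⟩ := SeparationQuotient.surjective_mk a
    rw [hX, SeparationQuotient.inner_mk_mk]
    exact hTp _
  · intro i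
    rw [hX]
    simp [T, Finsupp.mapDomain_single]
  · intro i j
    rw [SeparationQuotient.inner_mk_mk, hin]
    simp

/-- Truncated strong Stieltjes problem: the moments `S m` with `|m| ≤ n` are those of a finite sum
of rank-one point masses in `(0, ∞)`. -/
theorem exists_discrete_moments {N : ℕ} {S : ℤ → Matrix (Fin N) (Fin N) ℂ}
    (h0 : (Matrix.of fun p q : ℤ × Fin N => S (p.1 + q.1) p.2 q.2).PosSemidef)
    (h1 : (Matrix.of fun p q : ℤ × Fin N => S (p.1 + q.1 + 1) p.2 q.2).PosSemidef) (n : ℕ) :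
    ∃ (d : ℕ) (t : Fin d → ℝ) (c : Fin d → Fin N → ℂ), (∀ i, 0 < t i) ∧
      ∀ m : ℤ, |m| ≤ n → ∀ k l,
        S m k l = ∑ i, ((t i ^ m : ℝ) : ℂ) * (star (c i k) * c i l) := by
  classical
  obtain ⟨E, _, _, e, X, hXs, hXp, hXe, he⟩ := h0.exists_gram_shift (fun p => (p.1 + 1, p.2))
    (fun p q => by simp [add_assoc, add_comm (1 : ℤ)]) 
    (by convert h1 using 1; ext p q; simp [add_right_comm])
  -- The margin `n + 1` keeps `e (-1, k)` in the span even for `n = 0`, which `hzero` needs.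
  let F : Finset E := (Finset.Icc (-(n + 1 : ℤ)) (n + 1) ×ˢ (Finset.univ : Finset (Fin N))).image e
  let H : Submodule ℂ E := Submodule.span ℂ (F : Set E)
  have : FiniteDimensional ℂ H := FiniteDimensional.span_finset ℂ F
  have heH : ∀ (j : ℤ) (k), |j| ≤ n + 1 → e (j, k) ∈ H := by
    intro j k hj
    refine Submodule.subset_span ?_
    simp only [F, Finset.coe_image, Set.mem_image, Finset.mem_coe, Finset.mem_product,
      Finset.mem_Icc, Finset.mem_univ, and_true]
    exact ⟨(j, k), abs_le.1 hj, rfl⟩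
  let A : H →ₗ[ℂ] H := (H.orthogonalProjectionOnto : E →ₗ[ℂ] H) ∘ₗ X ∘ₗ H.subtype
  have hA : ∀ u v : H, inner ℂ (A u) v = inner ℂ (X u) (v : E) := by
    intro u v
    exact Submodule.inner_orthogonalProjectionOnto_eq_of_mem_right v (X u)
  have hAs : A.IsSymmetric := by
    intro u v
    rw [hA, ← inner_conj_symm u, hA, inner_conj_symm, hXs]
  let b := hAs.eigenvectorBasis rfl
  let μ := hAs.eigenvalues rfl
  have hμ : ∀ i, 0 ≤ μ i := by
    intro i
    refine eigenvalue_nonneg_of_nonneg (hAs.hasEigenvalue_eigenvalues rfl i) fun u => ?_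
    have := hXp u
    rw [← hA, hAs] at this
    exact this
  let g : ℤ → Fin N → H := fun j k => if hj : |j| ≤ n + 1 then ⟨e (j, k), heH j k hj⟩ else 0
  have hg : ∀ (j : ℤ) (k), |j| ≤ n + 1 → (g j k : E) = e (j, k) := by
    intro j k hj
    simp [g, hj]
  -- Inside the window `X` does not leave `H`, so the projection changes nothing.
  have hAg : ∀ (j : ℤ) (k), |j| ≤ n + 1 → |j + 1| ≤ n + 1 → A (g j k) = g (j + 1) k := by
    intro j k hj hj'
    have : X (g j k : E) = (g (j + 1) k : E) := by rw [hg j k hj, hg _ k hj', hXe]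
    simp only [A, LinearMap.comp_apply, Submodule.subtype_apply, this]
    exact Submodule.orthogonalProjectionOnto_mem_subspace_eq_self _
  have hstep : ∀ i (j : ℤ) (k), |j| ≤ n + 1 → |j + 1| ≤ n + 1 →
      inner ℂ (b i) (g (j + 1) k) = (μ i : ℂ) * inner ℂ (b i) (g j k) := by
    intro i j k hj hj'
    rw [← hAg j k hj hj', ← hAs, hAs.apply_eigenvectorBasis, inner_smul_left]
    simp [μ, b]
  -- `g 0 k = A (g (-1) k)` lies in the range of the symmetric `A`, hence is orthogonal to its
  -- kernel.
  have hzero : ∀ i k, μ i = 0 → inner ℂ (b i) (g 0 k) = 0 := by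
    intro i k hi
    have := hstep i (-1) k (by simp) (by simp; omega)
    simpa [hi] using this
  have hpos : ∀ i k (j : ℕ), j ≤ n → inner ℂ (b i) (g j k) =
      ((μ i ^ (j : ℤ) : ℝ) : ℂ) * inner ℂ (b i) (g 0 k) := by
    intro i k j
    induction j with
    | zero => intro _; simp
    | succ j ih =>
      intro hj
      have := hstep i j k (by rw [abs_le]; omega) (by rw [abs_le]; omega)
      push_cast at this ⊢
      rw [this, ih (by omega)]
      norm_cast
      push_cast
      ring
  have hneg : ∀ i k (j : ℕ), μ i ≠ 0 → j ≤ n → inner ℂ (b i) (g (-j : ℤ) k) =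
      ((μ i ^ (-j : ℤ) : ℝ) : ℂ) * inner ℂ (b i) (g 0 k) := by
    intro i k j hi
    have hi' : (μ i : ℂ) ≠ 0 := by exact_mod_cast hi
    induction j with
    | zero => intro _; simp
    | succ j ih =>
      intro hj
      have := hstep i (-(j + 1 : ℤ)) k (by rw [abs_le]; omega) (by rw [abs_le]; omega)
      rw [show (-(j + 1 : ℤ) + 1) = -j by ring, ih (by omega)] at this
      push_cast at this ⊢
      apply mul_left_cancel₀ hi'
      rw [← this, ← mul_assoc, neg_add, zpow_add₀ hi']
      field_simp
  refine ⟨_, fun i => if μ i = 0 then 1 else μ i, fun i k => inner ℂ (b i) (g 0 k), ?_, ?_⟩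
  · intro i
    dsimp only
    split_ifs with h
    · exact one_pos
    · exact lt_of_le_of_ne (hμ i) (Ne.symm h)
  · intro m hm k l
    have h2 : S m k l = inner ℂ (g 0 k) (g m l) := by
      rw [Submodule.coe_inner, hg 0 k (by simp; omega), hg m l (by omega), he]
      simp
    rw [h2, ← b.sum_inner_mul_inner]
    refine Finset.sum_congr rfl fun i _ => ?_
    dsimp only
    rw [← inner_conj_symm (g 0 k)]
    split_ifs with h
    · simp [hzero i _ h]
    · have : inner ℂ (b i) (g m l) = ((μ i ^ m : ℝ) : ℂ) * inner ℂ (b i) (g 0 l) := by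
        obtain ⟨j, rfl | rfl⟩ := m.eq_nat_or_neg
        · exact hpos i l j (by simpa using hm)
        · exact hneg i l j h (by simpa using hm)
      rw [this, RCLike.star_def]
      ring

/-! ### Quadratic forms and polarization -/

open Filter Topology CompactlySupported

/-- The polarization identity recovering a matrix from its quadratic form. -/
theorem Matrix.entry_eq_polarization {N : ℕ} (A : Matrix (Fin N) (Fin N) ℂ) (k l : Fin N) :
    A k l = (1 / 4 : ℂ) * ∑ s : Fin 4, (-Complex.I) ^ (s : ℕ) *
      (star (StieltjesMatrixFunction.polVec k l s) ⬝ᵥ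
        (A *ᵥ StieltjesMatrixFunction.polVec k l s)) := by
  simp only [StieltjesMatrixFunction.polVec, Fin.sum_univ_four, star_add, star_smul,
    Matrix.mulVec_add, Matrix.mulVec_smul, dotProduct_add, add_dotProduct, smul_dotProduct,
    dotProduct_smul]
  simp [pow_succ]
  ring_nf
  simp [Complex.I_sq]
  ring

/-- `G` is the quadratic form of a Hermitian matrix. -/
def IsMatrixForm {N : ℕ} (G : (Fin N → ℂ) → ℝ) : Prop :=
  ∃ A : Matrix (Fin N) (Fin N) ℂ, ∀ v, star v ⬝ᵥ (A *ᵥ v) = (G v : ℂ)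

/-- The matrix with polarized entries of `G`. -/
noncomputable def polarMatrix {N : ℕ} (G : (Fin N → ℂ) → ℝ) : Matrix (Fin N) (Fin N) ℂ :=
  Matrix.of fun k l => (1 / 4 : ℂ) * ∑ s : Fin 4, (-Complex.I) ^ (s : ℕ) *
    (G (StieltjesMatrixFunction.polVec k l s) : ℂ)

theorem eq_polarMatrix {N : ℕ} {G : (Fin N → ℂ) → ℝ} {A : Matrix (Fin N) (Fin N) ℂ}
    (h : ∀ v, star v ⬝ᵥ (A *ᵥ v) = (G v : ℂ)) : A = polarMatrix G := by
  ext k l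
  rw [A.entry_eq_polarization]
  simp [polarMatrix, h]

theorem tendsto_dotProduct_mulVec {ι : Type*} {N : ℕ} {L : Filter ι}
    {A : ι → Matrix (Fin N) (Fin N) ℂ} {B : Matrix (Fin N) (Fin N) ℂ}
    (h : Tendsto A L (𝓝 B)) (v w : Fin N → ℂ) :
    Tendsto (fun i => v ⬝ᵥ (A i *ᵥ w)) L (𝓝 (v ⬝ᵥ (B *ᵥ w))) := by
  have : Continuous fun C : Matrix (Fin N) (Fin N) ℂ => v ⬝ᵥ (C *ᵥ w) := by fun_prop
  exact (this.tendsto B).comp h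

theorem tendsto_polarMatrix {ι : Type*} {N : ℕ} {L : Filter ι} {G : ι → (Fin N → ℂ) → ℝ}
    {H : (Fin N → ℂ) → ℝ} (h : ∀ v, Tendsto (fun i => G i v) L (𝓝 (H v))) :
    Tendsto (fun i => polarMatrix (G i)) L (𝓝 (polarMatrix H)) := by
  refine tendsto_pi_nhds.2 fun k => tendsto_pi_nhds.2 fun l => ?_
  simp only [polarMatrix, Matrix.of_apply]
  refine Tendsto.const_mul _ (tendsto_finsetSum _ fun s _ => Tendsto.const_mul _ ?_)
  exact (Complex.continuous_ofReal.tendsto _).comp (h _)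

namespace IsMatrixForm

variable {N : ℕ} {G H : (Fin N → ℂ) → ℝ}

theorem polar (h : IsMatrixForm G) (v : Fin N → ℂ) :
    star v ⬝ᵥ (polarMatrix G *ᵥ v) = (G v : ℂ) := by
  obtain ⟨A, hA⟩ := h
  rw [← eq_polarMatrix hA, hA]

/-- Polarization writes the entries through finitely many values of the form, so pointwise
convergence of forms forces convergence of matrices. This carries the matrix structure through every
limit of scalar measures. -/
theorem of_tendsto {ι : Type*} {L : Filter ι} [L.NeBot] {G : ι → (Fin N → ℂ) → ℝ}
    (hG : ∀ i, IsMatrixForm (G i)) (h : ∀ v, Tendsto (fun i => G i v) L (𝓝 (H v))) :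
    IsMatrixForm H := by
  refine ⟨polarMatrix H, fun v => ?_⟩
  refine tendsto_nhds_unique (tendsto_dotProduct_mulVec (tendsto_polarMatrix h) (star v) v) ?_
  simp only [fun i => (hG i).polar v]
  exact (Complex.continuous_ofReal.tendsto _).comp (h v)

theorem zero : IsMatrixForm (fun _ : Fin N → ℂ => (0 : ℝ)) := ⟨0, by simp⟩

theorem add (hG : IsMatrixForm G) (hH : IsMatrixForm H) : IsMatrixForm fun v => G v + H v := by
  obtain ⟨A, hA⟩ := hG
  obtain ⟨B, hB⟩ := hH
  exact ⟨A + B, fun v => by simp [Matrix.add_mulVec, hA, hB]⟩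

theorem sub (hG : IsMatrixForm G) (hH : IsMatrixForm H) : IsMatrixForm fun v => G v - H v := by
  obtain ⟨A, hA⟩ := hG
  obtain ⟨B, hB⟩ := hH
  exact ⟨A - B, fun v => by simp [Matrix.sub_mulVec, hA, hB]⟩

theorem sum {ι : Type*} {s : Finset ι} {G : ι → (Fin N → ℂ) → ℝ}
    (hG : ∀ i ∈ s, IsMatrixForm (G i)) : IsMatrixForm fun v => ∑ i ∈ s, G i v := by
  classical
  induction s using Finset.induction_on with
  | empty => simpa using zero
  | insert i s hi ih =>
    simp only [Finset.sum_insert hi]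
    exact (hG i (by simp)).add (ih fun j hj => hG j (by simp [hj]))

/-- The form is real, so `A` and `Aᴴ` have the same form, and polarization determines the matrix. -/
theorem isHermitian {A : Matrix (Fin N) (Fin N) ℂ}
    (h : ∀ v, star v ⬝ᵥ (A *ᵥ v) = (G v : ℂ)) : A.IsHermitian := by
  have h' : ∀ v, star v ⬝ᵥ (Aᴴ *ᵥ v) = (G v : ℂ) := by
    intro v
    rw [Matrix.star_dotProduct, Matrix.star_mulVec, Matrix.conjTranspose_conjTranspose,
      ← Matrix.dotProduct_mulVec, h]
    simp
  rw [Matrix.IsHermitian, eq_polarMatrix h', eq_polarMatrix h]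

theorem posSemidef {A : Matrix (Fin N) (Fin N) ℂ}
    (h : ∀ v, star v ⬝ᵥ (A *ᵥ v) = (G v : ℂ)) (hG : ∀ v, 0 ≤ G v) : A.PosSemidef := by
  refine Matrix.PosSemidef.of_dotProduct_mulVec_nonneg (isHermitian h) fun v => ?_
  rw [h]
  exact_mod_cast hG v

end IsMatrixForm

/-! ### Cutoff functions on the open half-line -/

/-- The integral of `f` against the point masses `w i` at `t i`. -/
def pointSum {d : ℕ} (t w : Fin d → ℝ) (f : ℝ → ℝ) : ℝ := ∑ i, w i * f (t i)

/-- A continuous cutoff function supported in `[1 / (j + 1), j + 2]`. -/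
noncomputable def cutoff (j : ℕ) (x : ℝ) : ℝ :=
  min 1 (max 0 ((j + 1) * x - 1)) * min 1 (max 0 (j + 2 - x))

theorem continuous_cutoff (j : ℕ) : Continuous (cutoff j) := by
  unfold cutoff; fun_prop

theorem cutoff_nonneg (j : ℕ) (x : ℝ) : 0 ≤ cutoff j x :=
  mul_nonneg (le_min zero_le_one (le_max_left _ _)) (le_min zero_le_one (le_max_left _ _))

theorem cutoff_le_one (j : ℕ) (x : ℝ) : cutoff j x ≤ 1 :=
  mul_le_one₀ (min_le_left _ _) (le_min zero_le_one (le_max_left _ _)) (min_le_left _ _)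

theorem cutoff_eq_zero_of_le {j : ℕ} {x : ℝ} (hx : x ≤ 1 / (j + 1)) : cutoff j x = 0 := by
  have h : (j + 1) * x - 1 ≤ 0 := by
    rw [le_div_iff₀ (by positivity)] at hx
    linarith
  simp [cutoff, max_eq_left h]

theorem cutoff_eq_zero_of_ge {j : ℕ} {x : ℝ} (hx : (j + 2 : ℝ) ≤ x) : cutoff j x = 0 := by
  simp [cutoff, hx]

/-- The cutoff is `1` on `[2 / (j + 1), j + 1]`; to the left of it the term in `x⁻¹` exceeds `1`, to
the right the term in `x`. Multiplied by `x ^ m`, the bound involves only the moments of orders `m ±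
1`. -/
theorem one_sub_cutoff_le (j : ℕ) {x : ℝ} (hx : 0 < x) :
    1 - cutoff j x ≤ 2 / (j + 1) * (x + x⁻¹) := by
  have hj : (0 : ℝ) < j + 1 := by positivity
  rcases lt_or_ge x (2 / (j + 1)) with h | h
  · have h1 : 1 ≤ 2 / (j + 1) * x⁻¹ := by
      rw [← div_eq_mul_inv, one_le_div hx]
      exact h.le
    have h2 : 0 ≤ 2 / (j + 1) * x := by positivity
    linarith [cutoff_nonneg j x]
  · rcases lt_or_ge (j + 1 : ℝ) x with h' | h'
    · have h1 : 1 ≤ 2 / (j + 1) * x := by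
        rw [div_mul_eq_mul_div, one_le_div hj]
        linarith
      have h2 : 0 ≤ 2 / (j + 1) * x⁻¹ := by positivity
      linarith [cutoff_nonneg j x]
    · have h1 : cutoff j x = 1 := by
        rw [div_le_iff₀ hj] at h
        have h2 : 1 ≤ (j + 1) * x - 1 := by linarith
        have h3 : 1 ≤ (j + 2 : ℝ) - x := by linarith
        rw [cutoff, min_eq_left (h2.trans (le_max_right _ _)),
          min_eq_left (h3.trans (le_max_right _ _)), one_mul]
      rw [h1, sub_self]
      positivity

theorem tendsto_cutoff {x : ℝ} (hx : 0 < x) : Tendsto (fun j => cutoff j x) atTop (𝓝 1) := by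
  have h : Tendsto (fun j : ℕ => 1 - 2 * (x + x⁻¹) * (1 / ((j : ℝ) + 1))) atTop
      (𝓝 (1 - 2 * (x + x⁻¹) * 0)) :=
    tendsto_const_nhds.sub (tendsto_one_div_add_atTop_nhds_zero_nat.const_mul _)
  rw [mul_zero, sub_zero] at h
  refine tendsto_of_tendsto_of_tendsto_of_le_of_le h tendsto_const_nhds (fun j => ?_)
    fun j => cutoff_le_one j x
  have := one_sub_cutoff_le j hx
  have h2 : 2 / ((j : ℝ) + 1) * (x + x⁻¹) = 2 * (x + x⁻¹) * (1 / ((j : ℝ) + 1)) := by ring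
  dsimp only
  linarith

/-- Keeps the base away from `0`, so that negative powers become continuous on all of `ℝ`. -/
theorem zpow_mul_cutoff_eq (m : ℤ) (j : ℕ) :
    (fun x : ℝ => x ^ m * cutoff j x) =
      fun x : ℝ => (max x (1 / (j + 1))) ^ m * cutoff j x := by
  ext x
  rcases le_total x (1 / (j + 1)) with h | h
  · simp [cutoff_eq_zero_of_le h]
  · rw [max_eq_left h]

theorem continuous_zpow_mul_cutoff (m : ℤ) (j : ℕ) :
    Continuous fun x : ℝ => x ^ m * cutoff j x := by
  rw [zpow_mul_cutoff_eq]
  refine Continuous.mul ?_ (continuous_cutoff j)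
  refine Continuous.zpow₀ (by fun_prop) m fun x => Or.inl (ne_of_gt ?_)
  exact lt_max_of_lt_right (by positivity)

theorem hasCompactSupport_zpow_mul_cutoff (m : ℤ) (j : ℕ) :
    HasCompactSupport fun x : ℝ => x ^ m * cutoff j x := by
  refine HasCompactSupport.intro (K := Set.Icc (1 / (j + 1)) (j + 2)) isCompact_Icc fun x hx => ?_
  rw [Set.mem_Icc, not_and_or, not_le, not_le] at hx
  rcases hx with h | h
  · simp [cutoff_eq_zero_of_le h.le]
  · simp [cutoff_eq_zero_of_ge h.le]

section

variable {d : ℕ} {t w : Fin d → ℝ}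

theorem pointSum_mono (hw : ∀ i, 0 ≤ w i) {f g : ℝ → ℝ} (h : ∀ i, f (t i) ≤ g (t i)) :
    pointSum t w f ≤ pointSum t w g :=
  Finset.sum_le_sum fun i _ => mul_le_mul_of_nonneg_left (h i) (hw i)

theorem pointSum_add (f g : ℝ → ℝ) :
    pointSum t w (fun x => f x + g x) = pointSum t w f + pointSum t w g := by
  simp [pointSum, mul_add, Finset.sum_add_distrib]

theorem pointSum_smul (c : ℝ) (f : ℝ → ℝ) :
    pointSum t w (fun x => c * f x) = c * pointSum t w f := by
  simp only [pointSum, Finset.mul_sum]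
  exact Finset.sum_congr rfl fun i _ => by ring

end

/-! ### Limits of scalar discrete measures -/

/-- Along the hyperfilter, positive functionals of bounded mass converge on compactly supported
continuous functions to the integral against a measure. -/
theorem exists_measure_tendsto_pointSum {d : ℕ → ℕ} {t w : ∀ n, Fin (d n) → ℝ}
    (hw : ∀ n i, 0 ≤ w n i) {C : ℝ} (hC : ∀ n, pointSum (t n) (w n) (fun _ => 1) = C) :
    ∃ μ : Measure ℝ, IsFiniteMeasureOnCompacts μ ∧ ∀ f : ℝ → ℝ, Continuous f → HasCompactSupport f →
      Tendsto (fun n => pointSum (t n) (w n) f) (hyperfilter ℕ) (𝓝 (∫ x, f x ∂μ)) := by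
  have hex : ∀ f : C_c(ℝ, ℝ), ∃ a : ℝ,
      Tendsto (fun n => pointSum (t n) (w n) f) (hyperfilter ℕ) (𝓝 a) := by
    intro f
    obtain ⟨B, hB⟩ := f.hasCompactSupport.exists_bound_of_continuous f.continuous
    -- With total mass `C` and `|f| ≤ B` the values stay in a compact interval, where an ultrafilter
    -- must converge.
    have hmem : ∀ n, pointSum (t n) (w n) f ∈ Set.Icc (-B * C) (B * C) := by
      intro n
      rw [← hC n, ← pointSum_smul, ← pointSum_smul]
      refine ⟨pointSum_mono (hw n) fun i => ?_, pointSum_mono (hw n) fun i => ?_⟩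
      · simpa using (abs_le.1 (hB (t n i))).1
      · simpa using (abs_le.1 (hB (t n i))).2
    obtain ⟨a, -, ha⟩ := (isCompact_Icc (a := -B * C) (b := B * C)).ultrafilter_le_nhds'
      ((hyperfilter ℕ).map fun n => pointSum (t n) (w n) f)
      (by rw [Ultrafilter.mem_map]; exact Filter.Eventually.of_forall hmem)
    exact ⟨a, ha⟩
  choose Λ hΛ using hex
  let Λl : C_c(ℝ, ℝ) →ₗ[ℝ] ℝ :=
    { toFun := Λ
      map_add' := fun f g => tendsto_nhds_unique (hΛ (f + g)) (by
        have h := (hΛ f).add (hΛ g)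
        simp only [← pointSum_add] at h
        exact h)
      map_smul' := fun c f => tendsto_nhds_unique (hΛ (c • f)) (by
        have h := (hΛ f).const_mul c
        simp only [← pointSum_smul] at h
        exact h) }
  let Λp : C_c(ℝ, ℝ) →ₚ[ℝ] ℝ := PositiveLinearMap.mk₀ Λl fun f hf => by
    refine ge_of_tendsto' (hΛ f) fun n => ?_
    exact Finset.sum_nonneg fun i _ => mul_nonneg (hw n i) (hf (t n i))
  refine ⟨RealRMK.rieszMeasure Λp, inferInstance, fun f hf hf' => ?_⟩
  have := RealRMK.integral_rieszMeasure Λp ⟨⟨f, hf⟩, hf'⟩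
  have h2 : ∫ x, f x ∂(RealRMK.rieszMeasure Λp) = Λ ⟨⟨f, hf⟩, hf'⟩ := this
  rw [h2]
  exact hΛ _

/-- If discrete measures on `(0, ∞)` have eventually constant moments of all integer orders, then
they converge along the hyperfilter to a measure on `(0, ∞)` with these moments. -/
theorem exists_measure_of_pointSum_moments {d : ℕ → ℕ} {t w : ∀ n, Fin (d n) → ℝ}
    (ht : ∀ n i, 0 < t n i) (hw : ∀ n i, 0 ≤ w n i) {s : ℤ → ℝ}
    (hs : ∀ (n : ℕ) (m : ℤ), |m| ≤ n → pointSum (t n) (w n) (fun x => x ^ m) = s m) :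
    ∃ μ : Measure ℝ, IsFiniteMeasure μ ∧ μ (Set.Iic 0) = 0 ∧
      (∀ m : ℤ, Integrable (fun x => x ^ m) μ ∧ ∫ x, x ^ m ∂μ = s m) ∧
      ∀ f : ℝ → ℝ, Continuous f → HasCompactSupport f → (∀ x ≤ 0, f x = 0) →
        Tendsto (fun n => pointSum (t n) (w n) f) (hyperfilter ℕ) (𝓝 (∫ x, f x ∂μ)) := by
  obtain ⟨ν, hνc, hν⟩ := exists_measure_tendsto_pointSum (t := t) hw (C := s 0) fun n => by
    simpa using hs n 0 (by simp)
  have hres : ∀ f : ℝ → ℝ, (∀ x ≤ 0, f x = 0) →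
      ∫ x, f x ∂(ν.restrict (Set.Ioi 0)) = ∫ x, f x ∂ν := fun f hf =>
    setIntegral_eq_integral_of_forall_compl_eq_zero fun x hx => hf x (by simpa using hx)
  -- Restriction removes any mass on `(-∞, 0]`; it is invisible to test functions vanishing there,
  -- by `hres`.
  set μ := ν.restrict (Set.Ioi 0) with hμ
  have hpos : ∀ᵐ x ∂μ, 0 < x := ae_restrict_mem measurableSet_Ioi
  have hlim : ∀ f : ℝ → ℝ, Continuous f → HasCompactSupport f → (∀ x ≤ 0, f x = 0) →
      Tendsto (fun n => pointSum (t n) (w n) f) (hyperfilter ℕ) (𝓝 (∫ x, f x ∂μ)) := by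
    intro f hf hf' hf0
    rw [hres f hf0]
    exact hν f hf hf'
  have hlimc : ∀ (m : ℤ) (j : ℕ), Tendsto
      (fun n => pointSum (t n) (w n) fun x => x ^ m * cutoff j x) (hyperfilter ℕ)
      (𝓝 (∫ x, x ^ m * cutoff j x ∂μ)) := fun m j =>
    hlim _ (continuous_zpow_mul_cutoff m j) (hasCompactSupport_zpow_mul_cutoff m j) fun x hx => by
      rw [cutoff_eq_zero_of_le (hx.trans (by positivity)), mul_zero]
  have hev : ∀ M : ℕ, ∀ᶠ n in (hyperfilter ℕ : Filter ℕ), M ≤ n := fun M =>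
    (Nat.hyperfilter_le_atTop) (eventually_ge_atTop M)
  have hle : ∀ (m : ℤ) (j : ℕ), ∫ x, x ^ m * cutoff j x ∂μ ≤ s m := by
    intro m j
    refine le_of_tendsto (hlimc m j) ?_
    filter_upwards [hev m.natAbs] with n hn
    rw [← hs n m (by rw [abs_le]; omega)]
    refine pointSum_mono (hw n) fun i => ?_
    exact mul_le_of_le_one_right (zpow_nonneg (ht n i).le m) (cutoff_le_one _ _)
  -- The truncation error is bounded by neighbouring moments, uniformly in `n`; these are exact once
  -- `n ≥ |m| + 1`.
  have hge : ∀ (m : ℤ) (j : ℕ), s m - 2 / (j + 1) * (s (m + 1) + s (m - 1)) ≤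
      ∫ x, x ^ m * cutoff j x ∂μ := by
    intro m j
    refine ge_of_tendsto (hlimc m j) ?_
    filter_upwards [hev (m.natAbs + 1)] with n hn
    rw [sub_le_iff_le_add, ← hs n m (by rw [abs_le]; omega), ← hs n (m + 1) (by rw [abs_le]; omega),
      ← hs n (m - 1) (by rw [abs_le]; omega), ← pointSum_add, ← pointSum_smul, ← pointSum_add]
    refine pointSum_mono (hw n) fun i => ?_
    have hx := ht n i
    have h1 := mul_le_mul_of_nonneg_left (one_sub_cutoff_le j hx) (zpow_nonneg hx.le m)
    have h2 : t n i ^ (m + 1) + t n i ^ (m - 1) = t n i ^ m * (t n i + (t n i)⁻¹) := by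
      rw [zpow_add_one₀ hx.ne', zpow_sub_one₀ hx.ne']
      ring
    rw [h2]
    linarith
  have hint : ∀ m : ℤ, Integrable (fun x => x ^ m) μ := by
    intro m
    have hmeas : Measurable fun x : ℝ => x ^ m := by fun_prop
    refine ⟨hmeas.aestronglyMeasurable, ?_⟩
    -- Fatou's lemma along the cutoffs; the right-hand side is bounded through `hle`.
    have h1 : ∫⁻ x, ‖x ^ m‖ₑ ∂μ ≤
        liminf (fun j => ∫⁻ x, ENNReal.ofReal (x ^ m * cutoff j x) ∂μ) atTop := by
      refine le_trans (le_of_eq ?_) (lintegral_liminf_le fun j =>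
        (continuous_zpow_mul_cutoff m j).measurable.ennreal_ofReal)
      refine lintegral_congr_ae ?_
      filter_upwards [hpos] with x hx
      rw [Real.enorm_eq_ofReal (zpow_nonneg hx.le m)]
      refine (Tendsto.liminf_eq ?_).symm
      refine (ENNReal.continuous_ofReal.tendsto _).comp ?_
      simpa using (tendsto_cutoff hx).const_mul (x ^ m)
    have h2 : ∀ j, ∫⁻ x, ENNReal.ofReal (x ^ m * cutoff j x) ∂μ ≤ ENNReal.ofReal (s m) := by
      intro j
      rw [← ofReal_integral_eq_lintegral_ofReal]
      · exact ENNReal.ofReal_le_ofReal (hle m j)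
      · exact ((continuous_zpow_mul_cutoff m j).integrable_of_hasCompactSupport
          (hasCompactSupport_zpow_mul_cutoff m j)).restrict
      · filter_upwards [hpos] with x hx
        exact mul_nonneg (zpow_nonneg hx.le m) (cutoff_nonneg j x)
    have h3 := h1.trans (liminf_le_liminf (Eventually.of_forall h2))
    rw [liminf_const] at h3
    exact h3.trans_lt ENNReal.ofReal_lt_top
  refine ⟨μ, ?_, ?_, fun m => ⟨hint m, ?_⟩, hlim⟩
  · have := hint 0
    simpa [integrable_const_iff_isFiniteMeasure] using this
  · rw [hμ, Measure.restrict_apply measurableSet_Iic, Set.inter_comm, Set.Ioi_inter_Iic,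
      Set.Ioc_self, measure_empty]
  · have h1 : Tendsto (fun j => ∫ x, x ^ m * cutoff j x ∂μ) atTop (𝓝 (∫ x, x ^ m ∂μ)) := by
      refine tendsto_integral_of_dominated_convergence (fun x => |x ^ m|)
        (fun j => (continuous_zpow_mul_cutoff m j).aestronglyMeasurable) (hint m).abs
        (fun j => ae_of_all _ fun x => ?_) ?_
      · rw [Real.norm_eq_abs, abs_mul, abs_of_nonneg (cutoff_nonneg j x)]
        exact mul_le_of_le_one_right (abs_nonneg _) (cutoff_le_one j x)
      · filter_upwards [hpos] with x hx
        simpa using (tendsto_cutoff hx).const_mul (x ^ m)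
    have h2 : Tendsto (fun j : ℕ => s m - 2 * (s (m + 1) + s (m - 1)) * (1 / ((j : ℝ) + 1))) atTop
        (𝓝 (s m - 2 * (s (m + 1) + s (m - 1)) * 0)) :=
      tendsto_const_nhds.sub (tendsto_one_div_add_atTop_nhds_zero_nat.const_mul _)
    rw [mul_zero, sub_zero] at h2
    refine le_antisymm (le_of_tendsto' h1 (hle m)) (le_of_tendsto_of_tendsto' h2 h1 fun j => ?_)
    refine le_trans (le_of_eq ?_) (hge m j)
    ring

/-! ### Limits of matrix-valued discrete measures -/

/-- A continuous function increasing to the indicator function of `(0, x)` as `j → ∞`. -/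
noncomputable def innerCutoff (x : ℝ) (j : ℕ) (t : ℝ) : ℝ := min 1 (max 0 (j * (t * (x - t))))

theorem continuous_innerCutoff (x : ℝ) (j : ℕ) : Continuous (innerCutoff x j) := by
  unfold innerCutoff; fun_prop

theorem innerCutoff_eq_zero {x t : ℝ} (j : ℕ) (h : t * (x - t) ≤ 0) : innerCutoff x j t = 0 := by
  have : (j : ℝ) * (t * (x - t)) ≤ 0 := mul_nonpos_of_nonneg_of_nonpos (by positivity) h
  simp [innerCutoff, max_eq_left this]

theorem mul_sub_nonpos_of_notMem {x t : ℝ} (hx : 0 ≤ x) (h : t ∉ Set.Ioo 0 x) :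
    t * (x - t) ≤ 0 := by
  rw [Set.mem_Ioo, not_and_or, not_lt, not_lt] at h
  rcases h with h | h <;> nlinarith

theorem hasCompactSupport_innerCutoff {x : ℝ} (hx : 0 ≤ x) (j : ℕ) :
    HasCompactSupport (innerCutoff x j) :=
  HasCompactSupport.intro (K := Set.Icc 0 x) isCompact_Icc fun _ ht =>
    innerCutoff_eq_zero j (mul_sub_nonpos_of_notMem hx fun h => ht (Set.Ioo_subset_Icc_self h))

theorem tendsto_innerCutoff {x : ℝ} (hx : 0 ≤ x) (t : ℝ) :
    Tendsto (fun j => innerCutoff x j t) atTop (𝓝 ((Set.Ioo 0 x).indicator (fun _ => (1 : ℝ)) t)) := by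
  by_cases ht : t ∈ Set.Ioo 0 x
  · rw [Set.indicator_of_mem ht]
    have h : 0 < t * (x - t) := mul_pos ht.1 (sub_pos.2 ht.2)
    refine tendsto_const_nhds.congr' ?_
    have := (tendsto_natCast_atTop_atTop (R := ℝ)).atTop_mul_const h
    filter_upwards [this.eventually_ge_atTop 1] with j hj
    rw [innerCutoff, min_eq_left (hj.trans (le_max_right _ _))]
  · rw [Set.indicator_of_notMem ht]
    simp only [innerCutoff_eq_zero _ (mul_sub_nonpos_of_notMem hx ht)]
    exact tendsto_const_nhds

theorem isMatrixForm_normSq {N : ℕ} (c : Fin N → ℂ) (r : ℝ) :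
    IsMatrixForm fun v => Complex.normSq (∑ l, c l * v l) * r := by
  refine ⟨Matrix.of fun k l => star (c k) * c l * r, fun v => ?_⟩
  rw [Complex.ofReal_mul, Complex.normSq_eq_conj_mul_self]
  simp only [dotProduct, Matrix.mulVec, Matrix.of_apply, map_sum, Finset.sum_mul, Finset.mul_sum]
  rw [Finset.sum_comm]
  refine Finset.sum_congr rfl fun k _ => Finset.sum_congr rfl fun l _ => ?_
  simp
  ring

/-- A matrix-valued solution of the strong Stieltjes moment problem, in terms of the measures
`v* dM v`. -/
theorem exists_measures_of_posSemidef {N : ℕ} {S : ℤ → Matrix (Fin N) (Fin N) ℂ}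
    (h0 : (Matrix.of fun p q : ℤ × Fin N => S (p.1 + q.1) p.2 q.2).PosSemidef)
    (h1 : (Matrix.of fun p q : ℤ × Fin N => S (p.1 + q.1 + 1) p.2 q.2).PosSemidef) :
    ∃ μ : (Fin N → ℂ) → Measure ℝ, (∀ v, IsFiniteMeasure (μ v)) ∧ (∀ v, μ v (Set.Iic 0) = 0) ∧
      (∀ v (m : ℤ), Integrable (fun x => x ^ m) (μ v) ∧
        ((∫ x, x ^ m ∂(μ v) : ℝ) : ℂ) = star v ⬝ᵥ (S m *ᵥ v)) ∧
      ∀ x : ℝ, 0 ≤ x → IsMatrixForm fun v => (μ v).real (Set.Ioo 0 x) := by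
  choose d t c ht hS using exists_discrete_moments h0 h1
  let w : (Fin N → ℂ) → ∀ n, Fin (d n) → ℝ := fun v n i =>
    Complex.normSq (∑ l, c n i l * v l)
  have hw : ∀ v n i, 0 ≤ w v n i := fun v n i => Complex.normSq_nonneg _
  have hq : ∀ v (n : ℕ) (m : ℤ), |m| ≤ n →
      ((pointSum (t n) (w v n) (fun x => x ^ m) : ℝ) : ℂ) = star v ⬝ᵥ (S m *ᵥ v) := by
    intro v n m hm
    simp only [pointSum, w, dotProduct, Matrix.mulVec, hS n m hm, Complex.ofReal_sum,
      Complex.ofReal_mul, Complex.normSq_eq_conj_mul_self, map_sum, Finset.sum_mul, Finset.mul_sum]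
    conv_rhs => rw [Finset.sum_comm_cycle]
    refine Finset.sum_congr rfl fun i _ => ?_
    rw [Finset.sum_comm]
    refine Finset.sum_congr rfl fun k _ => Finset.sum_congr rfl fun l _ => ?_
    simp only [map_mul, Pi.star_apply, RCLike.star_def]
    ring
  have hs : ∀ v (n : ℕ) (m : ℤ), |m| ≤ n →
      pointSum (t n) (w v n) (fun x => x ^ m) = (star v ⬝ᵥ (S m *ᵥ v)).re := by
    intro v n m hm
    rw [← hq v n m hm, Complex.ofReal_re]
  choose μ hfin hzero hmom hlim using fun v =>
    exists_measure_of_pointSum_moments ht (hw v) (s := fun m => (star v ⬝ᵥ (S m *ᵥ v)).re) (hs v)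
  refine ⟨μ, hfin, hzero, fun v m => ⟨(hmom v m).1, ?_⟩, fun x hx => ?_⟩
  · rw [(hmom v m).2, ← hq v m.natAbs m (by simp), Complex.ofReal_re]
  -- The indicator of `(0, x)` is not continuous, so the limit in `n` is taken on continuous
  -- approximants first and `j → ∞` afterwards.
  · have hj : ∀ j, IsMatrixForm fun v => ∫ y, innerCutoff x j y ∂(μ v) := by
      intro j
      refine IsMatrixForm.of_tendsto (L := (hyperfilter ℕ : Filter ℕ))
        (G := fun n v => pointSum (t n) (w v n) (innerCutoff x j)) (fun n => ?_) fun v => ?_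
      · exact IsMatrixForm.sum fun i _ => isMatrixForm_normSq _ _
      · refine hlim v _ (continuous_innerCutoff x j) (hasCompactSupport_innerCutoff hx j)
          fun y hy => innerCutoff_eq_zero j (mul_sub_nonpos_of_notMem hx fun h => ?_)
        exact absurd h.1 (not_lt.2 hy)
    refine IsMatrixForm.of_tendsto (L := atTop) hj fun v => ?_
    rw [← integral_indicator_one measurableSet_Ioo]
    refine tendsto_integral_of_dominated_convergence (fun _ => 1)
      (fun j => (continuous_innerCutoff x j).aestronglyMeasurable) (integrable_const _)
      (fun j => ae_of_all _ fun y => ?_) (ae_of_all _ fun y => tendsto_innerCutoff hx y)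
    rw [Real.norm_eq_abs, abs_of_nonneg (le_min zero_le_one (le_max_left _ _))]
    exact min_le_left _ _

/-! ### The matrix function defined by the limit measures -/

theorem ofReal_zpow_of_pos {x : ℝ} (hx : 0 < x) (n : ℤ) :
    ENNReal.ofReal (x ^ n) = ENNReal.ofReal x ^ n := by
  obtain ⟨m, rfl | rfl⟩ := n.eq_nat_or_neg
  · simp [ENNReal.ofReal_pow hx.le]
  · rw [zpow_neg, ENNReal.ofReal_inv_of_pos (by positivity), ENNReal.zpow_neg, zpow_natCast,
      zpow_natCast, ENNReal.ofReal_pow hx.le]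

theorem tendsto_measureReal_Ioo_left (μ : Measure ℝ) [IsFiniteMeasure μ] (a x : ℝ) :
    Tendsto (fun y => μ.real (Set.Ioo a y)) (𝓝[≤] x) (𝓝 (μ.real (Set.Ioo a x))) := by
  simp only [← integral_indicator_one (measurableSet_Ioo (a := a))]
  refine tendsto_integral_filter_of_dominated_convergence (fun _ => 1) ?_ ?_
    (integrable_const _) ?_
  · exact Eventually.of_forall fun y =>
      (measurable_one.indicator measurableSet_Ioo).aestronglyMeasurable
  · refine Eventually.of_forall fun y => ae_of_all _ fun t => ?_
    by_cases h : t ∈ Set.Ioo a y <;> simp [h]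
  · refine ae_of_all _ fun t => ?_
    refine tendsto_const_nhds.congr' ?_
    rcases lt_or_ge t x with h | h
    · filter_upwards [mem_nhdsWithin_of_mem_nhds (lt_mem_nhds h)] with y hy
      simp only [Set.indicator, Set.mem_Ioo, h, show t < y from hy]
    · filter_upwards [self_mem_nhdsWithin] with y hy
      simp only [Set.indicator, Set.mem_Ioo, h.not_gt, ((Set.mem_Iic.1 hy).trans h).not_gt]

theorem tendsto_measureReal_Ioo_right (μ : Measure ℝ) [IsFiniteMeasure μ] (a x : ℝ) :
    Tendsto (fun y => μ.real (Set.Ioo a y)) (𝓝[>] x) (𝓝 (μ.real (Set.Ioc a x))) := by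
  simp only [← integral_indicator_one (measurableSet_Ioo (a := a)),
    ← integral_indicator_one (measurableSet_Ioc (a := a))]
  refine tendsto_integral_filter_of_dominated_convergence (fun _ => 1) ?_ ?_
    (integrable_const _) ?_
  · exact Eventually.of_forall fun y =>
      (measurable_one.indicator measurableSet_Ioo).aestronglyMeasurable
  · refine Eventually.of_forall fun y => ae_of_all _ fun t => ?_
    by_cases h : t ∈ Set.Ioo a y <;> simp [h]
  · refine ae_of_all _ fun t => ?_
    refine tendsto_const_nhds.congr' ?_
    rcases le_or_gt t x with h | h
    · filter_upwards [self_mem_nhdsWithin] with y hy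
      simp only [Set.indicator, Set.mem_Ioo, Set.mem_Ioc, h, h.trans_lt (Set.mem_Ioi.1 hy)]
    · filter_upwards [mem_nhdsWithin_of_mem_nhds (gt_mem_nhds h)] with y hy
      simp only [Set.indicator, Set.mem_Ioo, Set.mem_Ioc, h.not_ge,
        (show y < t from hy).le.not_gt]

theorem polarMatrix_sub {N : ℕ} (G H : (Fin N → ℂ) → ℝ) :
    polarMatrix (fun v => G v - H v) = polarMatrix G - polarMatrix H := by
  ext k l
  simp [polarMatrix, mul_sub, Finset.sum_sub_distrib]

namespace StieltjesMatrixFunction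

variable {N : ℕ}

/-- The matrix function with `v* M(x) v = μ v (0, x)`. -/
noncomputable def ofMeasures (μ : (Fin N → ℂ) → Measure ℝ) [∀ v, IsFiniteMeasure (μ v)]
    (h : ∀ x : ℝ, 0 ≤ x → IsMatrixForm fun v => (μ v).real (Set.Ioo 0 x)) :
    StieltjesMatrixFunction N where
  toFun x := polarMatrix fun v => (μ v).real (Set.Ioo 0 (x : ℝ))
  map_zero := by
    ext k l
    simp [polarMatrix]
  mono x y hxy := by
    rw [← polarMatrix_sub]
    refine IsMatrixForm.posSemidef ((h y y.2).sub (h x x.2)).polar fun v => ?_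
    exact sub_nonneg.2 (measureReal_mono (Set.Ioo_subset_Ioo_right hxy))
  left_continuous x _ := by
    refine tendsto_polarMatrix fun v => (tendsto_measureReal_Ioo_left (μ v) 0 x).comp ?_
    exact (NNReal.continuous_coe.continuousWithinAt (s := Set.Iic x)).tendsto_nhdsWithin
      fun y hy => hy

variable {μ : (Fin N → ℂ) → Measure ℝ} [∀ v, IsFiniteMeasure (μ v)]
    {h : ∀ x : ℝ, 0 ≤ x → IsMatrixForm fun v => (μ v).real (Set.Ioo 0 x)}

theorem quad_ofMeasures (v : Fin N → ℂ) (x : ℝ) :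
    (ofMeasures μ h).quad v x = (μ v).real (Set.Ioo 0 x) := by
  have := (h x.toNNReal x.toNNReal.2).polar v
  simp only [quad, ofMeasures]
  rw [this, Complex.ofReal_re]
  rcases le_total 0 x with hx | hx
  · rw [Real.coe_toNNReal x hx]
  · simp [Real.toNNReal_of_nonpos hx, Set.Ioo_eq_empty hx.not_gt]

/-- The Stieltjes function is the right limit of `y ↦ μ v (0, y)`, that is `μ v (0, x]`, which
equals `μ v (-∞, x]` as there is no mass on `(-∞, 0]`. Both measures thus agree on half-open
intervals. -/
theorem quadMeasure_ofMeasures (hμ : ∀ v, μ v (Set.Iic 0) = 0) (v : Fin N → ℂ) :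
    (ofMeasures μ h).quadMeasure v = μ v := by
  have hF : ∀ x, ((ofMeasures μ h).quad_mono v).stieltjesFunction x =
      (μ v).real (Set.Ioc 0 x) := by
    intro x
    rw [Monotone.stieltjesFunction_eq]
    refine rightLim_eq_of_tendsto ?_
    rw [show (ofMeasures μ h).quad v = fun y => (μ v).real (Set.Ioo 0 y) from
      funext (quad_ofMeasures v)]
    exact tendsto_measureReal_Ioo_right (μ v) 0 x
  refine Measure.ext_of_Ioc' _ _ (fun a b _ => ?_) fun a b hab => ?_
  · rw [quadMeasure, StieltjesFunction.measure_Ioc]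
    exact ENNReal.ofReal_ne_top
  · rw [quadMeasure, StieltjesFunction.measure_Ioc, hF, hF]
    have h1 : ∀ x, (μ v).real (Set.Ioc 0 x) = (μ v).real (Set.Iic x) := by
      intro x
      refine measureReal_congr ?_
      have : ∀ᵐ t ∂(μ v), t ∉ Set.Iic (0 : ℝ) := measure_eq_zero_iff_ae_notMem.1 (hμ v)
      filter_upwards [this] with t ht
      simp only [Set.mem_Iic, not_le] at ht
      exact propext ⟨fun h => h.2, fun h => ⟨ht, h⟩⟩
    rw [h1, h1, ← measureReal_sdiff (Set.Iic_subset_Iic.2 hab.le) measurableSet_Iic,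
      Set.Iic_sdiff_Iic, ofReal_measureReal]

theorem isSolution_ofMeasures {S : ℤ → Matrix (Fin N) (Fin N) ℂ}
    (hμ : ∀ v, μ v (Set.Iic 0) = 0)
    (hm : ∀ v (m : ℤ), Integrable (fun x => x ^ m) (μ v) ∧
        ((∫ x, x ^ m ∂(μ v) : ℝ) : ℂ) = star v ⬝ᵥ (S m *ᵥ v)) :
    (ofMeasures μ h).IsSolution S := by
  have hpos : ∀ v, ∀ᵐ x ∂(μ v), 0 < x := by
    intro v
    filter_upwards [measure_eq_zero_iff_ae_notMem.1 (hμ v)] with x hx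
    simpa using hx
  have hres : ∀ v, (μ v).restrict (Set.Ici 0) = μ v := by
    intro v
    refine Measure.restrict_eq_self_of_ae_mem ?_
    filter_upwards [hpos v] with x hx using hx.le
  refine fun n => ⟨fun v => ?_, ?_⟩
  · rw [quadMeasure_ofMeasures hμ, hres]
    have := (hm v n).1.2
    refine lt_of_le_of_lt (le_of_eq (lintegral_congr_ae ?_)) this
    filter_upwards [hpos v] with x hx
    rw [Real.enorm_eq_ofReal (zpow_nonneg hx.le n), ofReal_zpow_of_pos hx]
  · ext k l
    rw [(S n).entry_eq_polarization]
    simp only [moment, Matrix.of_apply, quadMeasure_ofMeasures hμ, hres, (hm _ n).2]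

end StieltjesMatrixFunction

/-! ### Necessity: the measures of a solution -/

namespace StieltjesMatrixFunction

variable {N : ℕ} (M : StieltjesMatrixFunction N)

theorem quad_of_nonpos (v : Fin N → ℂ) {x : ℝ} (hx : x ≤ 0) : M.quad v x = 0 := by
  simp [quad, Real.toNNReal_of_nonpos hx, M.map_zero]

theorem isMatrixForm_quad (x : ℝ) : IsMatrixForm fun v => M.quad v x := by
  refine ⟨M.toFun x.toNNReal, fun v => ?_⟩
  have hP : (M.toFun x.toNNReal).PosSemidef := by
    simpa [M.map_zero] using M.mono 0 x.toNNReal zero_le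
  exact Complex.eq_re_of_ofReal_le (r := 0) (by simpa using hP.dotProduct_mulVec_nonneg v)

theorem stieltjesFunction_quad_of_neg (v : Fin N → ℂ) {x : ℝ} (hx : x < 0) :
    (M.quad_mono v).stieltjesFunction x = 0 := by
  rw [Monotone.stieltjesFunction_eq]
  refine rightLim_eq_of_tendsto (tendsto_const_nhds.congr' ?_)
  filter_upwards [mem_nhdsWithin_of_mem_nhds (gt_mem_nhds hx)] with z hz
  exact (M.quad_of_nonpos v (le_of_lt hz)).symm

theorem tendsto_stieltjesFunction_quad_atBot (v : Fin N → ℂ) :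
    Tendsto (M.quad_mono v).stieltjesFunction atBot (𝓝 0) := by
  refine tendsto_const_nhds.congr' ?_
  filter_upwards [eventually_lt_atBot 0] with y hy
  exact (M.stieltjesFunction_quad_of_neg v hy).symm

theorem quadMeasure_Iic (v : Fin N → ℂ) (x : ℝ) : M.quadMeasure v (Set.Iic x) =
    ENNReal.ofReal ((M.quad_mono v).stieltjesFunction x) := by
  rw [quadMeasure, StieltjesFunction.measure_Iic _ (M.tendsto_stieltjesFunction_quad_atBot v),
    sub_zero]

theorem quadMeasure_Iio_zero (v : Fin N → ℂ) : M.quadMeasure v (Set.Iio 0) = 0 := by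
  rw [quadMeasure, StieltjesFunction.measure_Iio _ (M.tendsto_stieltjesFunction_quad_atBot v),
    leftLim_eq_of_tendsto (y := 0), sub_zero, ENNReal.ofReal_zero]
  refine tendsto_const_nhds.congr' ?_
  filter_upwards [self_mem_nhdsWithin] with y hy
  exact (M.stieltjesFunction_quad_of_neg v hy).symm

/-- Half-lines come from right limits of `M.quad`. The property passes to complements by subtraction
and to disjoint unions as a limit of finite sums, so it reaches all Borel sets by the π-λ theorem.
-/
theorem isMatrixForm_quadMeasure [∀ v, IsFiniteMeasure (M.quadMeasure v)] {A : Set ℝ}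
    (hA : MeasurableSet A) : IsMatrixForm fun v => (M.quadMeasure v).real A := by
  have hIic : ∀ x, IsMatrixForm fun v => (M.quadMeasure v).real (Set.Iic x) := by
    intro x
    refine IsMatrixForm.of_tendsto (L := 𝓝[>] x) M.isMatrixForm_quad fun v => ?_
    have h1 := (M.quad_mono v).tendsto_rightLim x
    have h2 : 0 ≤ (M.quad_mono v).stieltjesFunction x := by
      rw [Monotone.stieltjesFunction_eq]
      refine ge_of_tendsto h1 (Eventually.of_forall fun y => ?_)
      rw [← M.quad_of_nonpos v (min_le_right y 0)]
      exact M.quad_mono v (min_le_left _ _)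
    rw [measureReal_def, quadMeasure_Iic, ENNReal.toReal_ofReal h2, Monotone.stieltjesFunction_eq]
    exact h1
  have huniv : IsMatrixForm fun v => (M.quadMeasure v).real Set.univ := by
    refine IsMatrixForm.of_tendsto (L := (atTop : Filter ℝ)) hIic fun v => ?_
    exact (ENNReal.tendsto_toReal (measure_ne_top _ _)).comp (tendsto_measure_Iic_atTop _)
  induction A, hA using MeasurableSpace.induction_on_inter
    ((BorelSpace.measurable_eq (α := ℝ)).trans (borel_eq_generateFrom_Iic ℝ)) isPiSystem_Iic with
  | empty => simpa using IsMatrixForm.zero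
  | basic A hA =>
    obtain ⟨x, rfl⟩ := hA
    exact hIic x
  | compl A hA ih =>
    simp only [measureReal_compl hA]
    exact huniv.sub ih
  | iUnion f hd hf ih =>
    refine IsMatrixForm.of_tendsto (L := atTop) (G := fun n v => ∑ i ∈ Finset.range n,
      (M.quadMeasure v).real (f i)) (fun n => IsMatrixForm.sum fun i _ => ih i) fun v => ?_
    have h := measure_iUnion (μ := M.quadMeasure v) hd hf
    rw [measureReal_def, h, ENNReal.tsum_toReal_eq fun i => measure_ne_top _ _]
    refine (ENNReal.hasSum_toReal ?_).tendsto_sum_nat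
    rw [← h]
    exact measure_ne_top _ _

/-- The integrand `x⁻¹` is `∞` at `0`, so a finite integral forbids an atom there. -/
theorem ae_quadMeasure_pos {v : Fin N → ℂ} (h : M.MomentConverges (-1)) :
    ∀ᵐ x ∂(M.quadMeasure v), 0 < x := by
  have h1 : ∀ᵐ x ∂((M.quadMeasure v).restrict (Set.Ici 0)), ENNReal.ofReal x ^ (-1 : ℤ) < ∞ := by
    refine ae_lt_top' ?_ (h v).ne
    simp only [zpow_neg_one]
    fun_prop
  rw [ae_restrict_iff' measurableSet_Ici] at h1
  filter_upwards [h1, measure_eq_zero_iff_ae_notMem.1 (M.quadMeasure_Iio_zero v)] with x hx hx0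
  simp only [Set.mem_Iio, not_lt] at hx0
  refine lt_of_le_of_ne hx0 ?_
  rintro rfl
  simp [zpow_neg_one] at hx

theorem isFiniteMeasure_quadMeasure {v : Fin N → ℂ} (h : M.MomentConverges (-1))
    (h' : M.MomentConverges 0) : IsFiniteMeasure (M.quadMeasure v) := by
  constructor
  have := h' v
  rw [Measure.restrict_eq_self_of_ae_mem] at this
  · simpa using this
  · filter_upwards [M.ae_quadMeasure_pos h] with x hx using hx.le

theorem integrable_zpow_quadMeasure {v : Fin N → ℂ} {n : ℤ} (h : M.MomentConverges (-1))
    (h' : M.MomentConverges n) : Integrable (fun x => x ^ n) (M.quadMeasure v) := by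
  refine ⟨Measurable.aestronglyMeasurable (by fun_prop), ?_⟩
  have := h' v
  rw [Measure.restrict_eq_self_of_ae_mem
    (by filter_upwards [M.ae_quadMeasure_pos h] with x hx using hx.le)] at this
  refine lt_of_le_of_lt (le_of_eq (lintegral_congr_ae ?_)) this
  filter_upwards [M.ae_quadMeasure_pos h] with x hx
  rw [Real.enorm_eq_ofReal (zpow_nonneg hx.le n), ofReal_zpow_of_pos hx]

theorem moment_eq_polarMatrix (h : M.MomentConverges (-1)) (n : ℤ) :
    M.moment n = polarMatrix fun v => ∫ x, x ^ n ∂(M.quadMeasure v) := by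
  ext k l
  have this (v : Fin N → ℂ) : (M.quadMeasure v).restrict (Set.Ici 0) = M.quadMeasure v :=
    Measure.restrict_eq_self_of_ae_mem
      (by filter_upwards [M.ae_quadMeasure_pos h] with x hx using hx.le)
  simp only [moment, this, polarMatrix, Matrix.of_apply]

end StieltjesMatrixFunction

/-! ### Necessity: the positive semidefinite matrix density -/

/-- A finite linear combination of values of `G`, with coefficients independent of `G`: hence it
commutes with integration. -/
theorem dotProduct_polarMatrix_mulVec {N : ℕ} (u w : Fin N → ℂ) (G : (Fin N → ℂ) → ℝ) :
    u ⬝ᵥ (polarMatrix G *ᵥ w) = ∑ k, ∑ l, ∑ s : Fin 4,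
      (u k * w l * (1 / 4 * (-Complex.I) ^ (s : ℕ))) *
        (G (StieltjesMatrixFunction.polVec k l s) : ℂ) := by
  simp only [dotProduct, Matrix.mulVec, polarMatrix, Matrix.of_apply, Finset.mul_sum,
    Finset.sum_mul]
  refine Finset.sum_congr rfl fun k _ => Finset.sum_congr rfl fun l _ =>
    Finset.sum_congr rfl fun s _ => ?_
  ring

theorem integrable_dotProduct_polarMatrix {N : ℕ} {τ : Measure ℝ} {g : (Fin N → ℂ) → ℝ → ℝ}
    (hg : ∀ v, Integrable (g v) τ) (u w : Fin N → ℂ) :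
    Integrable (fun x => u ⬝ᵥ (polarMatrix (fun v => g v x) *ᵥ w)) τ := by
  simp only [dotProduct_polarMatrix_mulVec]
  exact integrable_finsetSum _ fun k _ => integrable_finsetSum _ fun l _ =>
    integrable_finsetSum _ fun s _ => (hg _).ofReal.const_mul _

theorem integral_dotProduct_polarMatrix {N : ℕ} {τ : Measure ℝ} {g : (Fin N → ℂ) → ℝ → ℝ}
    (hg : ∀ v, Integrable (g v) τ) (u w : Fin N → ℂ) :
    ∫ x, u ⬝ᵥ (polarMatrix (fun v => g v x) *ᵥ w) ∂τ =
      u ⬝ᵥ (polarMatrix (fun v => ∫ x, g v x ∂τ) *ᵥ w) := by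
  simp only [dotProduct_polarMatrix_mulVec]
  have h : ∀ (c : ℂ) v, Integrable (fun x => c * (g v x : ℂ)) τ := fun c v =>
    (hg v).ofReal.const_mul c
  rw [integral_finsetSum _ fun k _ => integrable_finsetSum _ fun l _ =>
    integrable_finsetSum _ fun s _ => h _ _]
  refine Finset.sum_congr rfl fun k _ => ?_
  rw [integral_finsetSum _ fun l _ => integrable_finsetSum _ fun s _ => h _ _]
  refine Finset.sum_congr rfl fun l _ => ?_
  rw [integral_finsetSum _ fun s _ => h _ _]
  refine Finset.sum_congr rfl fun s _ => ?_
  rw [integral_const_mul]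
  exact congrArg _ integral_ofReal

namespace StieltjesMatrixFunction

variable {N : ℕ} (M : StieltjesMatrixFunction N)

theorem polarMatrix_mul_const (G : (Fin N → ℂ) → ℝ) (r : ℝ) :
    polarMatrix (fun v => G v * r) = (r : ℂ) • polarMatrix G := by
  ext k l
  simp only [polarMatrix, Matrix.of_apply, Matrix.smul_apply, smul_eq_mul, Finset.mul_sum]
  refine Finset.sum_congr rfl fun s _ => ?_
  push_cast
  ring

/-- A finite measure dominating all the measures `v* dM v`. -/
noncomputable def dominatingMeasure : Measure ℝ :=
  ∑ p : Fin N × Fin N × Fin 4, M.quadMeasure (polVec p.1 p.2.1 p.2.2)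

/-- On a fixed set the mass is a form in `v`, so it vanishes for every `v` once it vanishes on the
polarization vectors. -/
theorem quadMeasure_absolutelyContinuous [∀ v, IsFiniteMeasure (M.quadMeasure v)]
    (v : Fin N → ℂ) : M.quadMeasure v ≪ M.dominatingMeasure := by
  refine Measure.AbsolutelyContinuous.mk fun A hA h => ?_
  have h1 : ∀ k l s, (M.quadMeasure (polVec k l s)).real A = 0 := by
    intro k l s
    rw [dominatingMeasure, Measure.finsetSum_apply, Finset.sum_eq_zero_iff] at h
    rw [measureReal_def, h (k, l, s) (Finset.mem_univ _), ENNReal.toReal_zero]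
  have h2 := (M.isMatrixForm_quadMeasure hA).polar v
  rw [dotProduct_polarMatrix_mulVec] at h2
  simp only [h1, Complex.ofReal_zero, mul_zero, Finset.sum_const_zero] at h2
  have h3 : (M.quadMeasure v).real A = 0 := by exact_mod_cast h2.symm
  exact (measureReal_eq_zero_iff).1 h3

theorem ae_dominatingMeasure_pos (h : M.MomentConverges (-1)) :
    ∀ᵐ x ∂M.dominatingMeasure, 0 < x := by
  rw [ae_iff, dominatingMeasure, Measure.finsetSum_apply, Finset.sum_eq_zero_iff]
  exact fun p _ => ae_iff.1 (M.ae_quadMeasure_pos h)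

/-- The density of `v* dM v` with respect to the dominating measure. -/
noncomputable def quadDensity (v : Fin N → ℂ) (x : ℝ) : ℝ :=
  ((M.quadMeasure v).rnDeriv M.dominatingMeasure x).toReal

variable [∀ v, IsFiniteMeasure (M.quadMeasure v)]

instance : IsFiniteMeasure M.dominatingMeasure := by
  unfold dominatingMeasure; infer_instance

theorem integrable_quadDensity (v : Fin N → ℂ) :
    Integrable (M.quadDensity v) M.dominatingMeasure :=
  Measure.integrable_toReal_rnDeriv

/-- Both sides have the same integral over every measurable `A`, because the masses of `A` form a
matrix form. -/
theorem ae_dotProduct_density (v : Fin N → ℂ) : ∀ᵐ x ∂M.dominatingMeasure,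
    star v ⬝ᵥ (polarMatrix (fun v => M.quadDensity v x) *ᵥ v) = (M.quadDensity v x : ℂ) := by
  refine Integrable.ae_eq_of_forall_setIntegral_eq _ _
    (integrable_dotProduct_polarMatrix M.integrable_quadDensity _ _)
    (M.integrable_quadDensity v).ofReal fun A hA _ => ?_
  have h1 : ∀ v, ∫ x in A, M.quadDensity v x ∂M.dominatingMeasure = (M.quadMeasure v).real A :=
    fun v => Measure.setIntegral_toReal_rnDeriv (M.quadMeasure_absolutelyContinuous v) A
  rw [integral_dotProduct_polarMatrix fun v => (M.integrable_quadDensity v).restrict]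
  simp only [h1, (M.isMatrixForm_quadMeasure hA).polar v]
  rw [← h1]
  exact integral_ofReal.symm

/-- The exceptional null set in `ae_dotProduct_density` depends on `v`; a countable dense set of
vectors and continuity in `v` give one null set for all. -/
theorem ae_dotProduct_density_nonneg : ∀ᵐ x ∂M.dominatingMeasure, ∀ v,
    0 ≤ star v ⬝ᵥ (polarMatrix (fun v => M.quadDensity v x) *ᵥ v) := by
  have h : ∀ᵐ x ∂M.dominatingMeasure, ∀ n, 0 ≤ star (TopologicalSpace.denseSeq (Fin N → ℂ) n) ⬝ᵥ
      (polarMatrix (fun v => M.quadDensity v x) *ᵥ TopologicalSpace.denseSeq (Fin N → ℂ) n) := by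
    refine ae_all_iff.2 fun n => ?_
    filter_upwards [M.ae_dotProduct_density (TopologicalSpace.denseSeq _ n)] with x hx
    rw [hx]
    exact_mod_cast ENNReal.toReal_nonneg
  filter_upwards [h] with x hx v
  refine (TopologicalSpace.denseRange_denseSeq (Fin N → ℂ)).induction_on
    (p := fun v => 0 ≤ star v ⬝ᵥ (polarMatrix (fun v => M.quadDensity v x) *ᵥ v)) v ?_ hx
  exact isClosed_le continuous_const (by fun_prop)

theorem integrable_quadDensity_mul {v : Fin N → ℂ} {f : ℝ → ℝ}
    (hf : Integrable f (M.quadMeasure v)) :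
    Integrable (fun x => M.quadDensity v x * f x) M.dominatingMeasure :=
  (integrable_rnDeriv_smul_iff (M.quadMeasure_absolutelyContinuous v)).2 hf

theorem integral_quadDensity_mul (v : Fin N → ℂ) (f : ℝ → ℝ) :
    ∫ x, M.quadDensity v x * f x ∂M.dominatingMeasure = ∫ x, f x ∂(M.quadMeasure v) :=
  integral_rnDeriv_smul (M.quadMeasure_absolutelyContinuous v)

variable {M} {S : ℤ → Matrix (Fin N) (Fin N) ℂ}

theorem IsSolution.dotProduct_mulVec (hM : M.IsSolution S) (n : ℤ) (u w : Fin N → ℂ) :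
    Integrable (fun x : ℝ => ((x ^ n : ℝ) : ℂ) *
      (u ⬝ᵥ (polarMatrix (fun v => M.quadDensity v x) *ᵥ w))) M.dominatingMeasure ∧
    u ⬝ᵥ (S n *ᵥ w) = ∫ x, ((x ^ n : ℝ) : ℂ) *
      (u ⬝ᵥ (polarMatrix (fun v => M.quadDensity v x) *ᵥ w)) ∂M.dominatingMeasure := by
  have h : ∀ v, Integrable (fun x => M.quadDensity v x * x ^ n) M.dominatingMeasure :=
    fun v => M.integrable_quadDensity_mul (M.integrable_zpow_quadMeasure (hM (-1)).1 (hM n).1)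
  have h1 := integrable_dotProduct_polarMatrix h u w
  have h2 := integral_dotProduct_polarMatrix h u w
  simp only [polarMatrix_mul_const, Matrix.smul_mulVec, dotProduct_smul, smul_eq_mul] at h1 h2
  refine ⟨h1, ?_⟩
  rw [h2, ← (hM n).2, M.moment_eq_polarMatrix (hM (-1)).1]
  simp only [integral_quadDensity_mul]

theorem IsSolution.posSemidef_blockHankel (hM : M.IsSolution S)
    (hS : ∀ n : ℤ, (S n).IsHermitian) (d : ℤ) (n : ℕ) : (blockHankel S d n).PosSemidef := by
  refine Matrix.PosSemidef.of_dotProduct_mulVec_nonneg ?_ fun z => ?_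
  · ext p q
    simp only [blockHankel, Matrix.conjTranspose_apply, Matrix.of_apply]
    rw [(hS _).apply, add_comm (q.1 : ℤ)]
  · let u : Set.Icc (-(n : ℤ)) n → Fin N → ℂ := fun i k => z (i, k)
    have h1 : star z ⬝ᵥ (blockHankel S d n *ᵥ z) =
        ∑ i : Set.Icc (-(n : ℤ)) n, ∑ j : Set.Icc (-(n : ℤ)) n, star (u i) ⬝ᵥ (S (i + j + d) *ᵥ u j) := by
      simp only [dotProduct, Matrix.mulVec, blockHankel, Matrix.of_apply, Fintype.sum_prod_type,
        Finset.mul_sum, u, Pi.star_apply]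
      exact Finset.sum_congr rfl fun i _ => Finset.sum_comm
    have h2 := fun i j : Set.Icc (-(n : ℤ)) n =>
      hM.dotProduct_mulVec (i + j + d) (star (u i)) (u j)
    rw [h1]
    simp only [fun i j => (h2 i j).2]
    simp only [← integral_finsetSum _ fun j _ => (h2 _ j).1]
    rw [← integral_finsetSum _ fun i _ => integrable_finsetSum _ fun j _ => (h2 i j).1]
    refine integral_nonneg_of_ae ?_
    filter_upwards [M.ae_dominatingMeasure_pos (hM (-1)).1, M.ae_dotProduct_density_nonneg]
      with x hx hD
    -- Since `x ^ (i + j + d) = x ^ d * x ^ i * x ^ j`, the integrand is `x ^ d` times the density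
    -- form at this vector.
    have h3 := hD (∑ i : Set.Icc (-(n : ℤ)) n, ((x ^ (i : ℤ) : ℝ) : ℂ) • u i)
    have h4 : (0 : ℂ) ≤ ((x ^ d : ℝ) : ℂ) := by exact_mod_cast zpow_nonneg hx.le d
    refine (mul_nonneg h4 h3).trans_eq ?_
    simp only [star_sum, sum_dotProduct, Matrix.mulVec_sum, dotProduct_sum, star_smul,
      smul_dotProduct, Matrix.mulVec_smul, dotProduct_smul, Finset.mul_sum, smul_eq_mul]
    rw [Finset.sum_comm]
    refine Finset.sum_congr rfl fun i _ => Finset.sum_congr rfl fun j _ => ?_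
    rw [zpow_add₀ hx.ne', zpow_add₀ hx.ne']
    simp
    ring

end StieltjesMatrixFunction

/-! ### From finite to infinite Hankel matrices, and the equivalence -/

/-- Positive semidefiniteness of the block Hankel matrices of all sizes amounts to that of the
infinite one. -/
theorem posSemidef_of_blockHankel {N : ℕ} {S : ℤ → Matrix (Fin N) (Fin N) ℂ} {d : ℤ}
    (h : ∀ n : ℕ, (blockHankel S d n).PosSemidef) :
    (Matrix.of fun p q : ℤ × Fin N => S (p.1 + q.1 + d) p.2 q.2).PosSemidef := by
  constructor
  · ext p q
    have hn := (h (p.1.natAbs + q.1.natAbs)).1.apply (⟨p.1, by rw [Set.mem_Icc]; omega⟩, p.2)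
      (⟨q.1, by rw [Set.mem_Icc]; omega⟩, q.2)
    exact hn
  · intro x
    let n := x.support.sup fun p => p.1.natAbs
    have hx : ∀ p ∈ x.support, p.1 ∈ Set.Icc (-(n : ℤ)) n := by
      intro p hp
      have : p.1.natAbs ≤ n := Finset.le_sup (f := fun p : ℤ × Fin N => p.1.natAbs) hp
      rw [Set.mem_Icc]
      omega
    let e : Set.Icc (-(n : ℤ)) n × Fin N → ℤ × Fin N := fun p => (p.1, p.2)
    have he : Function.Injective e := by
      rintro ⟨⟨a, _⟩, k⟩ ⟨⟨b, _⟩, l⟩ hab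
      simpa [e] using hab
    have hmap : Finsupp.mapDomain e (x.comapDomain e he.injOn) = x :=
      Finsupp.mapDomain_comapDomain e he x fun p hp => ⟨(⟨p.1, hx p hp⟩, p.2), rfl⟩
    have := (h n).2 (x.comapDomain e he.injOn)
    rw [← hmap]
    simpa [Finsupp.sum_mapDomain_index, add_mul, mul_add, blockHankel, e] using this

theorem theorem2p1 {N : ℕ} (S : ℤ → Matrix (Fin N) (Fin N) ℂ)
    (hS : ∀ n : ℤ, (S n).IsHermitian) :
    (∃ M : StieltjesMatrixFunction N, M.IsSolution S) ↔
      ∀ n : ℕ, (blockHankel S 0 n).PosSemidef ∧ (blockHankel S 1 n).PosSemidef := by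
  constructor
  · rintro ⟨M, hM⟩ n
    have this (v : Fin N → ℂ) : IsFiniteMeasure (M.quadMeasure v) :=
      M.isFiniteMeasure_quadMeasure (hM (-1)).1 (hM 0).1
    exact ⟨hM.posSemidef_blockHankel hS 0 n, hM.posSemidef_blockHankel hS 1 n⟩
  · intro h
    have h0 := posSemidef_of_blockHankel fun n => (h n).1
    simp only [add_zero] at h0
    obtain ⟨μ, hfin, hzero, hm, hform⟩ := exists_measures_of_posSemidef h0
      (posSemidef_of_blockHankel fun n => (h n).2)
    exact ⟨StieltjesMatrixFunction.ofMeasures μ hform,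
      StieltjesMatrixFunction.isSolution_ofMeasures hzero hm⟩
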